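/- For integers $m,n\ge 0$ let $$H_{m,n}(z_1,z_2)=\sum_{k=0}^{\min(m,n)}(-1)^k\,k!\binom{m}{k}\binom{n}{k}z_1^{m-k}z_2^{n-k}$$ be the (undeformed) complex Hermite polynomials. Let $x,y\in\mathbb R$, set $z=x+iy$, let $N\ge 0$ be an integer, and let $\Delta_N$ be the determinant of the $N\times N$ matrix whose entries are $$(-i)^{m+n}\,\pi\,H_{m,n}(iz,i\bar z),\qquad 0\le m,n<N .$$ Then, with $\zeta_k=r_k+is_k$, the integral below converges absolutely and $$\Delta_N=\frac1{N!}\int_{\mathbb R^{2N}}\Big[\prod_{1\le j<k\le N}|\zeta_j-\zeta_k|^2\Big]\prod_{j=1}^N e^{-(r_j-x)^2-(s_j-y)^2}\,dr_j\,ds_j .$$ (For $N=0$ both sides equal $1$.) -/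

import Mathlib

/-- The (undeformed) complex Hermite polynomial, as a polynomial function of two independent
complex variables:
`H_{m,n}(z₁, z₂) = ∑_{k=0}^{min m n} (-1)^k k! (m choose k) (n choose k) z₁^(m-k) z₂^(n-k)`. -/
noncomputable def complexHermite (m n : ℕ) (z₁ z₂ : ℂ) : ℂ :=
  ∑ k ∈ Finset.range (min m n + 1),
    (-1 : ℂ) ^ k * (Nat.factorial k : ℂ) * (Nat.choose m k : ℂ) * (Nat.choose n k : ℂ)
      * z₁ ^ (m - k) * z₂ ^ (n - k)

/-- The determinant `Δ_N` with entries `(-i)^(m+n) π H_{m,n}(iz, i z̄)`, `0 ≤ m, n < N`. -/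
noncomputable def hermiteDelta (N : ℕ) (z : ℂ) : ℂ :=
  Matrix.det (Matrix.of fun m n : Fin N =>
    (-Complex.I) ^ ((m : ℕ) + (n : ℕ)) * (Real.pi : ℂ)
      * complexHermite m n (Complex.I * z) (Complex.I * (starRingEnd ℂ) z))

/-- The integrand of the symmetrized Vandermonde integral over `ℝ^(2N)`, at the point
`(r_1, s_1, …, r_N, s_N)` with `p j = (r_j, s_j)` and `ζ_j = r_j + i s_j`:
`∏_{j<k} |ζ_j - ζ_k|² · ∏_j exp(-(r_j - x)² - (s_j - y)²)`. -/
noncomputable def vandermondeGaussian (N : ℕ) (x y : ℝ) (p : Fin N → ℝ × ℝ) : ℝ :=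
  (∏ j : Fin N, ∏ k ∈ Finset.Ioi j,
      ‖(((p j).1 : ℂ) + ((p j).2 : ℂ) * Complex.I)
        - (((p k).1 : ℂ) + ((p k).2 : ℂ) * Complex.I)‖ ^ 2)
    * ∏ j : Fin N, Real.exp (-((p j).1 - x) ^ 2 - ((p j).2 - y) ^ 2)

open MeasureTheory Matrix Equiv

/-! This is Andréief's identity for a Gaussian weight. The entries of the determinant are the
moments of `ζ^m * conj ζ^n` under the Gaussian centred at `z`
(`integral_pow_mul_conj_pow_mul_exp_sub`). The squared Vandermonde is a product of two determinants;
expanded over pairs of permutations, it integrates by Fubini to products of moments, and the signed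
sum of these is `N!` times the determinant. -/

theorem sum_sum_sign_mul_prod_eq_factorial_mul_det {ι R : Type*} [Fintype ι] [DecidableEq ι]
    [CommRing R] (M : Matrix ι ι R) :
    ∑ σ : Perm ι, ∑ τ : Perm ι, ((Perm.sign σ : ℤ) : R) * ((Perm.sign τ : ℤ) : R)
        * ∏ j, M (σ j) (τ j) = (Fintype.card ι).factorial * M.det := by
  -- For fixed `σ` the sum over `τ` is `sign σ` times the determinant with rows permuted by `σ`, so
  -- the signs cancel.
  have h (σ : Perm ι) : ∑ τ : Perm ι, ((Perm.sign σ : ℤ) : R) * ((Perm.sign τ : ℤ) : R)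
        * ∏ j, M (σ j) (τ j) = M.det := by
    have h1 := det_permute σ M
    rw [← det_transpose, det_apply'] at h1
    simp only [transpose_apply, submatrix_apply, id] at h1
    simp only [mul_assoc, ← Finset.mul_sum]
    rw [h1, ← mul_assoc, ← Int.cast_mul, ← Units.val_mul, Int.units_mul_self]
    simp
  simp [h, Fintype.card_perm]

/-- The squared modulus of the Vandermonde product, expanded over pairs of permutations. -/
theorem prod_norm_sub_sq_eq_sum (N : ℕ) (v : Fin N → ℂ) :
    ((∏ j : Fin N, ∏ k ∈ Finset.Ioi j, ‖v j - v k‖ ^ 2 : ℝ) : ℂ) =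
      ∑ σ : Perm (Fin N), ∑ τ : Perm (Fin N), ((Perm.sign σ : ℤ) : ℂ) * ((Perm.sign τ : ℤ) : ℂ)
        * ∏ j, (v j ^ (σ j : ℕ) * (starRingEnd ℂ) (v j) ^ (τ j : ℕ)) := by
  have h : ((∏ j : Fin N, ∏ k ∈ Finset.Ioi j, ‖v j - v k‖ ^ 2 : ℝ) : ℂ) =
      (vandermonde v)ᵀ.det * (vandermonde fun j => (starRingEnd ℂ) (v j))ᵀ.det := by
    rw [det_transpose, det_transpose, det_vandermonde, det_vandermonde, Complex.ofReal_prod,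
      ← Finset.prod_mul_distrib]
    refine Finset.prod_congr rfl fun j _ => ?_
    rw [Complex.ofReal_prod, ← Finset.prod_mul_distrib]
    refine Finset.prod_congr rfl fun k _ => ?_
    rw [← map_sub, Complex.mul_conj, Complex.normSq_eq_norm_sq, norm_sub_rev]
  rw [h, det_apply', det_apply', Finset.sum_mul_sum]
  refine Finset.sum_congr rfl fun σ _ => Finset.sum_congr rfl fun τ _ => ?_
  simp only [transpose_apply, vandermonde_apply, Finset.prod_mul_distrib]
  ring

theorem integral_norm_pow_mul_exp_neg_norm_sq (n : ℕ) :
    ∫ w : ℂ, ‖w‖ ^ n * Real.exp (-‖w‖ ^ 2) = Real.pi * Real.Gamma ((n + 2) / 2) := by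
  have h := Complex.integral_rpow_mul_exp_neg_rpow (p := 2) (q := n) (by norm_num)
    (by have : (0 : ℝ) ≤ n := n.cast_nonneg
        linarith)
  norm_cast at h
  simpa using h

theorem integrable_norm_pow_mul_exp_neg_norm_sq (n : ℕ) :
    Integrable fun w : ℂ => ‖w‖ ^ n * Real.exp (-‖w‖ ^ 2) := by
  -- A non-integrable function has integral `0` by convention, so a nonzero value forces
  -- integrability.
  refine Integrable.of_integral_ne_zero ?_
  rw [integral_norm_pow_mul_exp_neg_norm_sq]
  exact (mul_pos Real.pi_pos (Real.Gamma_pos_of_pos (by positivity))).ne'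

theorem integrable_pow_mul_conj_pow_mul_exp (m n : ℕ) :
    Integrable fun w : ℂ => w ^ m * (starRingEnd ℂ) w ^ n * (Real.exp (-‖w‖ ^ 2) : ℂ) := by
  refine (integrable_norm_pow_mul_exp_neg_norm_sq (m + n)).mono'
    (Continuous.aestronglyMeasurable (by fun_prop)) (Filter.Eventually.of_forall fun w => ?_)
  simp only [norm_mul, norm_pow, RCLike.norm_conj, Complex.norm_real, Real.norm_eq_abs,
    Real.abs_exp, pow_add]
  exact le_rfl

theorem integral_pow_mul_conj_pow_mul_exp (m n : ℕ) :
    ∫ w : ℂ, w ^ m * (starRingEnd ℂ) w ^ n * (Real.exp (-‖w‖ ^ 2) : ℂ) =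
      if m = n then (Real.pi : ℂ) * (n.factorial : ℂ) else 0 := by
  split_ifs with hmn
  · subst hmn
    have h (w : ℂ) : w ^ m * (starRingEnd ℂ) w ^ m * (Real.exp (-‖w‖ ^ 2) : ℂ) =
        ((‖w‖ ^ (2 * m) * Real.exp (-‖w‖ ^ 2) : ℝ) : ℂ) := by
      rw [← mul_pow, Complex.mul_conj, Complex.normSq_eq_norm_sq]
      push_cast
      ring
    simp only [h]
    rw [integral_complex_ofReal, integral_norm_pow_mul_exp_neg_norm_sq]
    have : (((2 * m : ℕ) : ℝ) + 2) / 2 = m + 1 := by push_cast; ring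
    rw [this, Real.Gamma_nat_eq_factorial]
    push_cast; rfl
  · set F : ℂ → ℂ := fun w => w ^ m * (starRingEnd ℂ) w ^ n * (Real.exp (-‖w‖ ^ 2) : ℂ)
    have hne : (m : ℂ) - n ≠ 0 := sub_ne_zero.2 (by exact_mod_cast hmn)
    -- Rotation by `θ = π / (m - n)` multiplies `w^m * conj w^n` by `exp (i (m - n) θ) = -1` and
    -- preserves the weight, so the integral equals its own negative.
    set c : Circle := Circle.exp (Real.pi / ((m : ℝ) - n))
    have hc : (c : ℂ) ^ m * (starRingEnd ℂ) c ^ n = -1 := by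
      rw [← Circle.coe_inv_eq_conj, ← Circle.exp_neg, Circle.coe_exp, Circle.coe_exp,
        ← Complex.exp_nat_mul, ← Complex.exp_nat_mul, ← Complex.exp_add, ← Complex.exp_pi_mul_I]
      congr 1
      push_cast
      field_simp
      ring
    have hrot : ∫ w, F (rotation c w) = ∫ w, F w :=
      (rotation c).measurePreserving.integral_comp
        (rotation c).toHomeomorph.measurableEmbedding F
    have hF (w : ℂ) : F (rotation c w) = -F w := by
      simp only [F, rotation_apply, norm_mul, Circle.norm_coe, one_mul, map_mul, mul_pow]
      linear_combination (w ^ m * (starRingEnd ℂ) w ^ n * (Real.exp (-‖w‖ ^ 2) : ℂ)) * hc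
    simp only [hF, integral_neg] at hrot
    exact self_eq_neg.1 hrot.symm

theorem add_pow_mul_conj_add_pow_eq_sum (m n : ℕ) (w z : ℂ) (e : ℂ) :
    (w + z) ^ m * (starRingEnd ℂ) (w + z) ^ n * e =
      ∑ j ∈ Finset.range (m + 1), ∑ l ∈ Finset.range (n + 1),
        (z ^ (m - j) * (starRingEnd ℂ) z ^ (n - l) * (m.choose j) * (n.choose l))
          * (w ^ j * (starRingEnd ℂ) w ^ l * e) := by
  rw [map_add, add_pow, add_pow, Finset.sum_mul_sum, Finset.sum_mul]
  refine Finset.sum_congr rfl fun j _ => ?_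
  rw [Finset.sum_mul]
  exact Finset.sum_congr rfl fun l _ => by ring

theorem integrable_pow_mul_conj_pow_mul_exp_sub (m n : ℕ) (z : ℂ) :
    Integrable fun w : ℂ => w ^ m * (starRingEnd ℂ) w ^ n * (Real.exp (-‖w - z‖ ^ 2) : ℂ) := by
  have h : Integrable fun w : ℂ =>
      (w + z) ^ m * (starRingEnd ℂ) (w + z) ^ n * (Real.exp (-‖w‖ ^ 2) : ℂ) := by
    simp only [add_pow_mul_conj_add_pow_eq_sum]
    exact integrable_finsetSum _ fun j _ => integrable_finsetSum _ fun l _ =>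
      (integrable_pow_mul_conj_pow_mul_exp j l).const_mul _
  simpa using h.comp_sub_right z

/-- After centring the Gaussian and expanding binomially, orthogonality keeps only the diagonal
terms `j = l`, each with weight `π j!`; the powers of `I` absorb the alternating sign of the Hermite
sum. -/
theorem integral_pow_mul_conj_pow_mul_exp_sub (m n : ℕ) (z : ℂ) :
    ∫ w : ℂ, w ^ m * (starRingEnd ℂ) w ^ n * (Real.exp (-‖w - z‖ ^ 2) : ℂ) =
      (-Complex.I) ^ (m + n) * (Real.pi : ℂ)
        * complexHermite m n (Complex.I * z) (Complex.I * (starRingEnd ℂ) z) := by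
  rw [← integral_add_right_eq_self _ z]
  simp only [add_sub_cancel_right, add_pow_mul_conj_add_pow_eq_sum]
  rw [integral_finsetSum _ fun j _ => integrable_finsetSum _ fun l _ =>
    (integrable_pow_mul_conj_pow_mul_exp j l).const_mul _]
  have hsub : Finset.range (min m n + 1) ⊆ Finset.range (m + 1) := by
    intro k
    simp only [Finset.mem_range]
    omega
  rw [complexHermite, Finset.mul_sum]
  symm
  refine Finset.sum_subset_zero_on_sdiff hsub ?_ ?_
  -- Here `n < j ≤ m`, so the diagonal index `l = j` is out of range.
  · intro j hj
    rw [integral_finsetSum _ fun l _ => (integrable_pow_mul_conj_pow_mul_exp j l).const_mul _]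
    simp only [integral_const_mul, integral_pow_mul_conj_pow_mul_exp, mul_ite, mul_zero]
    rw [Finset.sum_ite_eq, if_neg]
    simp only [Finset.mem_sdiff, Finset.mem_range] at hj ⊢
    omega
  · intro j hj
    rw [integral_finsetSum _ fun l _ => (integrable_pow_mul_conj_pow_mul_exp j l).const_mul _]
    simp only [integral_const_mul, integral_pow_mul_conj_pow_mul_exp, mul_ite, mul_zero]
    simp only [Finset.mem_range] at hj
    rw [Finset.sum_ite_eq, if_pos (by simp only [Finset.mem_range]; omega)]
    obtain ⟨a, rfl⟩ : ∃ a, m = a + j := ⟨m - j, by omega⟩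
    obtain ⟨b, rfl⟩ : ∃ b, n = b + j := ⟨n - j, by omega⟩
    simp only [Nat.add_sub_cancel, mul_pow, pow_add, neg_pow Complex.I]
    have hI (k : ℕ) : (-1 : ℂ) ^ k * Complex.I ^ k * Complex.I ^ k = 1 := by
      rw [← mul_pow, ← mul_pow, neg_one_mul, neg_mul, Complex.I_mul_I, neg_neg, one_pow]
    have hI' (k : ℕ) : (-1 : ℂ) ^ k * (-1) ^ k = 1 := by
      rw [← mul_pow, neg_one_mul, neg_neg, one_pow]
    -- The two sides differ by a product of four phases, each equal to `1`; they are removed one at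
    -- a time.
    linear_combination (Real.pi * j.factorial * ((a + j).choose j) * ((b + j).choose j)
      * z ^ a * (starRingEnd ℂ) z ^ b) *
      (((-1 : ℂ) ^ b * Complex.I ^ b * Complex.I ^ b * (((-1 : ℂ) ^ j * Complex.I ^ j * Complex.I ^ j)
        * ((-1 : ℂ) ^ j * (-1) ^ j))) * hI a
        + (((-1 : ℂ) ^ j * Complex.I ^ j * Complex.I ^ j) * ((-1 : ℂ) ^ j * (-1) ^ j)) * hI b
        + ((-1 : ℂ) ^ j * (-1) ^ j) * hI j + hI' j)

/-- The monomial `ζ^m ζ̄^n` times the Gaussian weight centred at `(x, y)`, in the real coordinates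
`ζ = r + i s`. -/
noncomputable def gaussianMonomial (x y : ℝ) (m n : ℕ) (p : ℝ × ℝ) : ℂ :=
  ((p.1 : ℂ) + (p.2 : ℂ) * Complex.I) ^ m
    * (starRingEnd ℂ) ((p.1 : ℂ) + (p.2 : ℂ) * Complex.I) ^ n
    * (Real.exp (-(p.1 - x) ^ 2 - (p.2 - y) ^ 2) : ℂ)

theorem gaussianMonomial_eq_comp (x y : ℝ) (m n : ℕ) :
    gaussianMonomial x y m n =
      (fun w : ℂ => w ^ m * (starRingEnd ℂ) w ^ n
        * (Real.exp (-‖w - ((x : ℂ) + (y : ℂ) * Complex.I)‖ ^ 2) : ℂ))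
          ∘ Complex.measurableEquivRealProd.symm := by
  funext p
  have h : (-(p.1 - x) ^ 2 - (p.2 - y) ^ 2) =
      -‖((p.1 : ℂ) + (p.2 : ℂ) * Complex.I) - ((x : ℂ) + (y : ℂ) * Complex.I)‖ ^ 2 := by
    rw [← Complex.normSq_eq_norm_sq, Complex.normSq_apply]
    simp
    ring
  rw [Function.comp_apply, Complex.measurableEquivRealProd_symm_apply, Complex.mk_eq_add_mul_I,
    gaussianMonomial, h]

theorem integrable_gaussianMonomial (x y : ℝ) (m n : ℕ) :
    Integrable (gaussianMonomial x y m n) := by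
  rw [gaussianMonomial_eq_comp]
  exact (Complex.volume_preserving_equiv_real_prod.symm.integrable_comp_emb
    Complex.measurableEquivRealProd.symm.measurableEmbedding).2
      (integrable_pow_mul_conj_pow_mul_exp_sub m n _)

theorem integral_gaussianMonomial (x y : ℝ) (m n : ℕ) :
    ∫ p, gaussianMonomial x y m n p =
      (-Complex.I) ^ (m + n) * (Real.pi : ℂ)
        * complexHermite m n (Complex.I * ((x : ℂ) + (y : ℂ) * Complex.I))
          (Complex.I * (starRingEnd ℂ) ((x : ℂ) + (y : ℂ) * Complex.I)) := by
  rw [← integral_pow_mul_conj_pow_mul_exp_sub, gaussianMonomial_eq_comp]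
  exact Complex.volume_preserving_equiv_real_prod.symm.integral_comp
    Complex.measurableEquivRealProd.symm.measurableEmbedding fun w : ℂ =>
      w ^ m * (starRingEnd ℂ) w ^ n
        * (Real.exp (-‖w - ((x : ℂ) + (y : ℂ) * Complex.I)‖ ^ 2) : ℂ)

theorem ofReal_vandermondeGaussian (N : ℕ) (x y : ℝ) (p : Fin N → ℝ × ℝ) :
    (vandermondeGaussian N x y p : ℂ) =
      ∑ σ : Perm (Fin N), ∑ τ : Perm (Fin N), ((Perm.sign σ : ℤ) : ℂ) * ((Perm.sign τ : ℤ) : ℂ)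
        * ∏ j, gaussianMonomial x y (σ j) (τ j) (p j) := by
  rw [vandermondeGaussian, Complex.ofReal_mul,
    prod_norm_sub_sq_eq_sum N fun j => ((p j).1 : ℂ) + ((p j).2 : ℂ) * Complex.I, Finset.sum_mul]
  refine Finset.sum_congr rfl fun σ _ => ?_
  rw [Finset.sum_mul]
  refine Finset.sum_congr rfl fun τ _ => ?_
  rw [Complex.ofReal_prod, mul_assoc, ← Finset.prod_mul_distrib]
  rfl

theorem corollary3p2 (N : ℕ) (x y : ℝ) :
    MeasureTheory.Integrable (vandermondeGaussian N x y) ∧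
    hermiteDelta N ((x : ℂ) + (y : ℂ) * Complex.I) =
      ((1 / (Nat.factorial N : ℝ) *
        ∫ p : Fin N → ℝ × ℝ, vandermondeGaussian N x y p : ℝ) : ℂ) := by
  have hint (σ τ : Perm (Fin N)) : Integrable fun p : Fin N → ℝ × ℝ =>
      ((Perm.sign σ : ℤ) : ℂ) * ((Perm.sign τ : ℤ) : ℂ)
        * ∏ j, gaussianMonomial x y (σ j) (τ j) (p j) :=
    (Integrable.fintype_prod fun j => integrable_gaussianMonomial x y (σ j) (τ j)).const_mul _
  refine ⟨?_, ?_⟩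
  · have h : Integrable fun p => (vandermondeGaussian N x y p : ℂ) := by
      simp only [ofReal_vandermondeGaussian]
      exact integrable_finsetSum _ fun σ _ => integrable_finsetSum _ fun τ _ => hint σ τ
    simpa using h.re
  · have hfac : (N.factorial : ℂ) ≠ 0 := by exact_mod_cast N.factorial_ne_zero
    have h : ((∫ p, vandermondeGaussian N x y p : ℝ) : ℂ) =
        N.factorial * hermiteDelta N ((x : ℂ) + (y : ℂ) * Complex.I) := by
      rw [← integral_complex_ofReal]
      simp only [ofReal_vandermondeGaussian]
      rw [integral_finsetSum _ fun σ _ => integrable_finsetSum _ fun τ _ => hint σ τ]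
      have hsum := sum_sum_sign_mul_prod_eq_factorial_mul_det
        (Matrix.of fun m n : Fin N => ∫ p, gaussianMonomial x y m n p)
      rw [Fintype.card_fin] at hsum
      simp only [hermiteDelta, ← integral_gaussianMonomial]
      rw [← hsum]
      refine Finset.sum_congr rfl fun σ _ => ?_
      rw [integral_finsetSum _ fun τ _ => hint σ τ]
      refine Finset.sum_congr rfl fun τ _ => ?_
      rw [integral_const_mul]
      congr 1
      exact integral_fintype_prod_volume_eq_prod fun j => gaussianMonomial x y (σ j) (τ j)
    rw [Complex.ofReal_mul, h]
    push_cast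
    field_simp
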